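/- Let $s\ge 3$ and $\ell\ge 0$ be integers and let $q$ be a prime power. There is a constant $C>0$, depending only on $s$, $q$ and $\ell$, such that the following holds. Let $\mathbb F_q$ be the field with $q$ elements and let $c_1,\dots,c_s\in\mathbb F_q[t]\setminus\{0\}$ satisfy $\max_i\deg c_i=\ell$. Suppose that the equation $$c_1x_1+\cdots+c_sx_s=0\qquad(*)$$ has genus $m\ge 1$; that is, $m$ is the largest integer for which there is a partition of $\{1,\dots,s\}$ into $m$ disjoint nonempty sets $T_1,\dots,T_m$ with $\sum_{i\in T_j}c_i=0$ for every $j$ (such an $m$ exists if and only if $c_1+\cdots+c_s=0$). For an integer $N\ge 0$ let $G_N=\{x\in\mathbb F_q[t]:\deg x<N\}$ (with $0\in G_N$), so $|G_N|=q^N$. Then for every $N\ge 0$ and every nonempty $A\subseteq G_N$ whose density $\alpha=|A|/|G_N|$ satisfies $\alpha<1/e^2$ we have $$\Lambda(A)\ \ge\ \exp\!\left(-C\,\alpha^{-1/(s-2)}\,(\log(1/\alpha))^4\right),$$ where $\Lambda(A)\,|G_N|^{s-1}$ is the number of all solutions $(x_1,\dots,x_s)\in A^s$ of $(*)$, the trivial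 ones (those with $x_i=x_{i'}$ whenever $i,i'$ lie in the same $T_j$, for some such partition) included. -/

import Mathlib

open scoped Polynomial

noncomputable section

namespace TranslationInvariant

/-- The additive group `G_N` of polynomials over `F` of degree strictly less than `N`
(the zero polynomial included), as a set of polynomials. -/
def truncation (F : Type*) [Field F] (N : ℕ) : Set F[X] :=
  {x | x.degree < (N : WithBot ℕ)}

/-- The equation `c₁ x₁ + ⋯ + cₛ xₛ = 0` has genus `m`: the number `m` is the largest one such that
`{1, …, s}` can be partitioned into `m` nonempty sets over each of which the coefficients
sum to zero. -/
def HasGenus {R : Type*} [CommRing R] {s : ℕ} (c : Fin s → R) (m : ℕ) : Prop :=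
  IsGreatest {k : ℕ | ∃ P : Finpartition (Finset.univ : Finset (Fin s)),
    P.parts.card = k ∧ ∀ T ∈ P.parts, ∑ i ∈ T, c i = 0} m

/-- All the solutions of `c₁ x₁ + ⋯ + cₛ xₛ = 0` with every `xᵢ` in `A`, trivial ones included. -/
def solutions {R : Type*} [CommRing R] {s : ℕ} (c : Fin s → R) (A : Set R) : Set (Fin s → R) :=
  {x | (∀ i, x i ∈ A) ∧ ∑ i, c i * x i = 0}

/-- The density `|A| / |G_N|` of a subset `A` of `G_N`. -/
def density {F : Type*} [Field F] (N : ℕ) (A : Set F[X]) : ℝ :=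
  (A.ncard : ℝ) / ((truncation F N).ncard : ℝ)

/-- `Λ(A)`: the number of solutions with all variables in `A`, divided by `|G_N| ^ (s - 1)`. -/
def solutionDensity {F : Type*} [Field F] {s : ℕ} (N : ℕ) (c : Fin s → F[X]) (A : Set F[X]) : ℝ :=
  ((solutions c A).ncard : ℝ) / ((truncation F N).ncard : ℝ) ^ (s - 1)

end TranslationInvariant

end

open Finset

/-! The count in fact obeys a polynomial bound, Λ(A) ≥ α^κ / K with κ and K depending only on s, q,
ℓ (`exists_supersaturation`). As α < 1/e², both log(1/α) and α^(-1/(s-2)) are at least 1, so the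
required exponential lies below α^κ / K once C is large. The genus enters through ∑ c_i = 0.

For three variables, an F-linear embedding turns the problem into counting zero-sum triples in a
finite field E, where all diagonal triples are solutions. The slice-rank method bounds tricoloured
sum-free sets in F^k by 3 q^(k(1-δ)) with δ > 0 (`card_le_of_tricolored_sum_free`,
`exists_card_lowExponents_pow_le`). To turn this into a count, apply random affine maps of E, keep
the triples that land in a k-dimensional subspace W, and discard those sharing a coordinate with
another survivor. What is left is tricoloured sum-free, hence small, while an average shows that it
is a fixed proportion of what was sampled (`exists_card_isolatedTriples`). This needs every element
to lie in few triples, which holds in a subset S minimizing #triples / |S|^(j+2); minimality carries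
the bound back to A.

For more variables, a pair with c_0 + c_1 ≠ 0 splits the equation into a shorter one and a
three-variable one glued along a common variable. If no such pair exists, the equation is ∑ x_i = 0
in characteristic two, and Cauchy-Schwarz suffices. -/

/-! ### Slice rank of diagonal tensors -/

/-- A vector of maximal support works: if its support were smaller than the dimension, some nonzero
`u` in `V` would vanish on it, and adding `u` would enlarge the support. -/
theorem exists_mem_finrank_le_card_support {F ι : Type*} [Field F] [Finite F] [Fintype ι]
    [DecidableEq F] (V : Submodule F (ι → F)) :
    ∃ v ∈ V, Module.finrank F V ≤ #{i | v i ≠ 0} := by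
  classical
  obtain ⟨⟨v, hv⟩, hmax⟩ := Finite.exists_max (fun v : V => #{i | (v : ι → F) i ≠ 0})
  refine ⟨v, hv, ?_⟩
  by_contra! hlt
  let r : V →ₗ[F] ({i // v i ≠ 0} → F) :=
    (LinearMap.funLeft F F (Subtype.val : {i // v i ≠ 0} → ι)).comp V.subtype
  have hker : LinearMap.ker r ≠ ⊥ := by
    apply LinearMap.ker_ne_bot_of_finrank_lt
    rwa [Module.finrank_fintype_fun_eq_card, Fintype.card_subtype]
  obtain ⟨u, hu, hu0⟩ := Submodule.exists_mem_ne_zero_of_ne_bot hker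
  have hu' : ∀ i, v i ≠ 0 → (u : ι → F) i = 0 := fun i hi =>
    congrFun (LinearMap.mem_ker.1 hu) ⟨i, hi⟩
  have : ∃ i, (u : ι → F) i ≠ 0 := by
    by_contra! h
    exact hu0 (Subtype.ext (funext h))
  obtain ⟨i₀, hi₀⟩ := this
  have hlt' : #{i | v i ≠ 0} < #{i | ((⟨v, hv⟩ + u : V) : ι → F) i ≠ 0} := by
    apply Finset.card_lt_card
    refine (Finset.ssubset_iff_of_subset ?_).2 ⟨i₀, ?_, ?_⟩
    · intro i hi
      simp only [mem_filter, mem_univ, true_and] at hi ⊢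
      simpa [hu' i hi] using hi
    · simp only [mem_filter, mem_univ, true_and]
      have : v i₀ = 0 := by by_contra h; exact hi₀ (hu' _ h)
      simpa [this] using hi₀
    · simp only [mem_filter, mem_univ, true_and, not_not]
      by_contra h; exact hi₀ (hu' _ h)
  exact absurd (hmax (⟨v, hv⟩ + u)) (not_le.2 hlt')

/-- The decomposition factors the diagonal matrix of `h` through `I₂ ⊕ I₃`, which bounds its rank.
-/
theorem card_support_le_of_diagonal_eq {F J I₂ I₃ : Type*} [Field F] [DecidableEq F] [Fintype J]
    [DecidableEq J] [Fintype I₂] [Fintype I₃] (h : J → F)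
    (f₂ g₂ : I₂ → J → F) (f₃ g₃ : I₃ → J → F)
    (H : ∀ b c, (if b = c then h b else 0) = ∑ i, f₂ i b * g₂ i c + ∑ i, f₃ i c * g₃ i b) :
    #{i | h i ≠ 0} ≤ Fintype.card I₂ + Fintype.card I₃ := by
  let A : Matrix J (I₂ ⊕ I₃) F := Matrix.of fun b => Sum.elim (fun i => f₂ i b) (fun i => g₃ i b)
  let B : Matrix (I₂ ⊕ I₃) J F := Matrix.of fun i c => Sum.elim (fun i => g₂ i c) (fun i => f₃ i c) i
  have hAB : Matrix.diagonal h = A * B := by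
    ext b c
    rw [Matrix.diagonal_apply, H, Matrix.mul_apply, Fintype.sum_sum_type]
    simp [A, B, mul_comm]
  rw [← Fintype.card_subtype, ← Matrix.rank_diagonal, hAB, ← Fintype.card_sum]
  exact (Matrix.rank_mul_le_left _ _).trans (Matrix.rank_le_card_width _)

/-- The slice rank of a diagonal `3`-tensor is at least its size. -/
theorem card_le_of_slice_decomposition {F J I₁ I₂ I₃ : Type*} [Field F] [Finite F] [Fintype J]
    [DecidableEq J] [Fintype I₁] [Fintype I₂] [Fintype I₃]
    (f₁ : I₁ → J → F) (g₁ : I₁ → J → J → F) (f₂ : I₂ → J → F) (g₂ : I₂ → J → J → F)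
    (f₃ : I₃ → J → F) (g₃ : I₃ → J → J → F)
    (H : ∀ a b c, (if a = b ∧ b = c then 1 else 0) =
      ∑ i, f₁ i a * g₁ i b c + ∑ i, f₂ i b * g₂ i a c + ∑ i, f₃ i c * g₃ i a b) :
    Fintype.card J ≤ Fintype.card I₁ + Fintype.card I₂ + Fintype.card I₃ := by
  classical
  let φ : (J → F) →ₗ[F] (I₁ → F) := Matrix.mulVecLin (Matrix.of f₁)
  -- Contracting the first coordinate against `h` kills the slices of the first kind and leaves the
  -- diagonal matrix of `h`, whose rank is at least `|J| - |I₁|`.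
  obtain ⟨h, hh, hcard⟩ := exists_mem_finrank_le_card_support (LinearMap.ker φ)
  have hφ : ∀ i, ∑ a, h a * f₁ i a = 0 := fun i => by
    have := congrFun (LinearMap.mem_ker.1 hh) i
    simpa [φ, Matrix.mulVec, dotProduct, mul_comm] using this
  have hrank : Fintype.card J ≤ Fintype.card I₁ + Module.finrank F (LinearMap.ker φ) := by
    have h1 := LinearMap.finrank_range_add_finrank_ker φ
    have h2 := Submodule.finrank_le (LinearMap.range φ)
    rw [Module.finrank_fintype_fun_eq_card] at h1 h2
    omega
  have := card_support_le_of_diagonal_eq h f₂ (fun i c => ∑ a, h a * g₂ i a c) f₃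
    (fun i b => ∑ a, h a * g₃ i a b) (by
      intro b c
      have e : ∑ a, h a * (if a = b ∧ b = c then (1 : F) else 0) = if b = c then h b else 0 := by
        by_cases hbc : b = c <;> simp [hbc]
      rw [← e]
      simp_rw [H, mul_add, Finset.sum_add_distrib, Finset.mul_sum]
      rw [Finset.sum_comm (s := univ) (t := (univ : Finset I₁)),
        Finset.sum_comm (s := univ) (t := (univ : Finset I₂)),
        Finset.sum_comm (s := univ) (t := (univ : Finset I₃))]
      simp_rw [← mul_assoc, ← Finset.sum_mul, hφ]
      simp only [zero_mul, sum_const_zero, zero_add]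
      congr 1 <;> refine Finset.sum_congr rfl fun i _ => ?_ <;>
        exact Finset.sum_congr rfl fun _ _ => by ring)
  omega

/-! ### Counting exponent vectors of low degree -/

/-- Exponent vectors with entries at most `m` and sum at most a third of `m * k`. -/
def lowExponents (m k : ℕ) : Finset (Fin k → ℕ) :=
  {u ∈ Fintype.piFinset fun _ => range (m + 1) | 3 * ∑ t, u t ≤ m * k}

/-- Both sides agree at `y = 1`. The mean of `3 * i` over `0, …, m` is `3m/2 > m`, so the left side
has the larger derivative there and is smaller just below 1. -/
theorem exists_sum_pow_lt (m : ℕ) (hm : 1 ≤ m) :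
    ∃ y : ℝ, 0 < y ∧ y < 1 ∧ ∑ i ∈ range (m + 1), y ^ (3 * i) < (m + 1) * y ^ m := by
  let g : ℝ → ℝ := fun y => (m + 1) * y ^ m - ∑ i ∈ range (m + 1), y ^ (3 * i)
  have hg1 : g 1 = 0 := by simp [g]
  have hder : HasDerivAt g (((m : ℝ) + 1) * (m * 1 ^ (m - 1)) -
      ∑ i ∈ range (m + 1), ((3 * i : ℕ) : ℝ) * 1 ^ (3 * i - 1)) 1 := by
    apply HasDerivAt.sub
    · exact (hasDerivAt_pow m (1 : ℝ)).const_mul _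
    · exact HasDerivAt.fun_sum fun i _ => hasDerivAt_pow (3 * i) (1 : ℝ)
  have hsum : ∑ i ∈ range (m + 1), ((3 * i : ℕ) : ℝ) * 1 ^ (3 * i - 1) = 3 * (m * (m + 1) / 2) := by
    have := Finset.sum_range_id_mul_two (m + 1)
    rw [Nat.add_sub_cancel] at this
    have h2 : (∑ i ∈ range (m + 1), (i : ℝ)) * 2 = (m + 1) * m := by
      rw [← Nat.cast_sum]; exact_mod_cast this
    simp only [one_pow, mul_one, Nat.cast_mul, Nat.cast_ofNat, ← Finset.mul_sum]
    linarith
  have hneg : ((m : ℝ) + 1) * (m * 1 ^ (m - 1)) -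
      ∑ i ∈ range (m + 1), ((3 * i : ℕ) : ℝ) * 1 ^ (3 * i - 1) < 0 := by
    rw [hsum]
    have : (1 : ℝ) ≤ m := by exact_mod_cast hm
    simp only [one_pow, mul_one]
    nlinarith
  have hslope := hasDerivAt_iff_tendsto_slope.1 hder
  have hev : ∀ᶠ y in nhdsWithin (1 : ℝ) (Set.Iio 1), slope g 1 y < 0 :=
    (hslope.mono_left (nhdsWithin_mono _ fun y hy => ne_of_lt hy)).eventually_lt_const hneg
  have hev2 : ∀ᶠ y in nhdsWithin (1 : ℝ) (Set.Iio 1), 0 < y :=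
    nhdsWithin_le_nhds (eventually_gt_nhds one_pos)
  obtain ⟨y, ⟨hy, hy0⟩, hy1⟩ := ((hev.and hev2).and self_mem_nhdsWithin).exists
  refine ⟨y, hy0, hy1, ?_⟩
  rw [slope_def_field, hg1, sub_zero] at hy
  have hy1' : y - 1 < 0 := sub_neg.2 hy1
  have : 0 < g y := by
    by_contra! h
    exact absurd hy (not_lt.2 (div_nonneg_of_nonpos h hy1'.le))
  simpa [g] using this

/-- Exponential moments: a low vector `u` has `y ^ (m * k) ≤ y ^ (3 * ∑ u)`, and the sum of the
right side over the whole box factorizes. -/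
theorem card_lowExponents_mul_le (m k : ℕ) {y : ℝ} (hy0 : 0 < y) (hy1 : y < 1) :
    (#(lowExponents m k) : ℝ) * (y ^ m) ^ k ≤ (∑ i ∈ range (m + 1), y ^ (3 * i)) ^ k := by
  have h1 : (∑ i ∈ range (m + 1), y ^ (3 * i)) ^ k =
      ∑ u ∈ Fintype.piFinset fun _ : Fin k => range (m + 1), ∏ t, y ^ (3 * u t) := by
    rw [Finset.sum_prod_piFinset (range (m + 1)) fun (_ : Fin k) i => y ^ (3 * i)]; simp
  rw [h1, ← nsmul_eq_mul, ← Finset.sum_const]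
  refine le_trans (Finset.sum_le_sum fun u hu => ?_)
    (Finset.sum_le_sum_of_subset_of_nonneg (Finset.filter_subset _ _) fun u _ _ =>
      Finset.prod_nonneg fun t _ => by positivity)
  rw [Finset.prod_pow_eq_pow_sum, ← pow_mul, ← Finset.mul_sum]
  exact pow_le_pow_of_le_one hy0.le hy1.le (Finset.mem_filter.1 hu).2

theorem exists_card_lowExponents_pow_le (m : ℕ) (hm : 1 ≤ m) :
    ∃ j : ℕ, ∀ k : ℕ, #(lowExponents m k) ^ (j + 1) ≤ ((m + 1) ^ k) ^ j := by
  obtain ⟨y, hy0, hy1, hy⟩ := exists_sum_pow_lt m hm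
  set σ := ∑ i ∈ range (m + 1), y ^ (3 * i) with hσ
  have hσ0 : 0 ≤ σ := Finset.sum_nonneg fun i _ => by positivity
  set ρ := σ / y ^ m with hρ
  have hq0 : (0 : ℝ) < m + 1 := by positivity
  have hρ0 : 0 ≤ ρ := by positivity
  have hρ1 : ρ / (m + 1) < 1 := by
    rw [div_lt_one hq0, hρ, div_lt_iff₀ (by positivity)]; exact hy
  -- With `n = j + 1` this gives `ρ ^ (j + 1) ≤ (m + 1) ^ j`: a saving of `1 / (j + 1)` in the
  -- exponent, uniform in `k`.
  obtain ⟨n, hn⟩ := exists_pow_lt_of_lt_one (show (0 : ℝ) < 1 / (m + 1) by positivity) hρ1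
  have hn0 : n ≠ 0 := by
    rintro rfl
    rw [pow_zero, lt_div_iff₀ hq0] at hn
    have : (1 : ℝ) ≤ m := by exact_mod_cast hm
    linarith
  obtain ⟨j, rfl⟩ := Nat.exists_eq_succ_of_ne_zero hn0
  refine ⟨j, fun k => ?_⟩
  have hρj : ρ ^ (j + 1) ≤ ((m : ℝ) + 1) ^ j := by
    rw [Nat.succ_eq_add_one, div_pow, div_lt_div_iff₀ (by positivity) hq0, pow_succ ((m : ℝ) + 1),
      one_mul] at hn
    exact (lt_of_mul_lt_mul_right hn hq0.le).le
  have hcard : (#(lowExponents m k) : ℝ) ≤ ρ ^ k := by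
    rw [hρ, div_pow, le_div_iff₀ (by positivity)]
    exact card_lowExponents_mul_le m k hy0 hy1
  have : (#(lowExponents m k) : ℝ) ^ (j + 1) ≤ (((m : ℝ) + 1) ^ k) ^ j :=
    calc (#(lowExponents m k) : ℝ) ^ (j + 1) ≤ (ρ ^ k) ^ (j + 1) := by gcongr
      _ = (ρ ^ (j + 1)) ^ k := by rw [← pow_mul, ← pow_mul, mul_comm]
      _ ≤ (((m : ℝ) + 1) ^ j) ^ k := by gcongr
      _ = _ := by rw [← pow_mul, ← pow_mul, mul_comm]
  exact_mod_cast this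

/-! ### The polynomial method for tricoloured sum-free sets -/

theorem exists_three_variable_expansion {F : Type*} [Field F] (m : ℕ) :
    ∃ (S : Finset (Fin 3 → ℕ)) (C : (Fin 3 → ℕ) → F), (∀ d ∈ S, d 0 + d 1 + d 2 ≤ m) ∧
      ∀ x y z : F, 1 - (x + y + z) ^ m = ∑ d ∈ S, C d * (x ^ d 0 * y ^ d 1 * z ^ d 2) := by
  classical
  let p : MvPolynomial (Fin 3) F :=
    1 - (MvPolynomial.X 0 + MvPolynomial.X 1 + MvPolynomial.X 2) ^ m
  have hdeg : p.totalDegree ≤ m := by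
    refine (MvPolynomial.totalDegree_sub _ _).trans (max_le ?_ ?_)
    · simp
    · refine (MvPolynomial.totalDegree_pow _ _).trans ?_
      have : (MvPolynomial.X 0 + MvPolynomial.X 1 + MvPolynomial.X 2 :
          MvPolynomial (Fin 3) F).totalDegree ≤ 1 := by
        refine (MvPolynomial.totalDegree_add _ _).trans (max_le
          ((MvPolynomial.totalDegree_add _ _).trans (max_le ?_ ?_)) ?_) <;>
        simp
      nlinarith
  refine ⟨p.support.map ⟨fun d : Fin 3 →₀ ℕ => ⇑d, DFunLike.coe_injective⟩,
    fun d => p.coeff (Finsupp.equivFunOnFinite.symm d), ?_, ?_⟩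
  · intro d hd
    obtain ⟨e, he, rfl⟩ := Finset.mem_map.1 hd
    have := (MvPolynomial.le_totalDegree he).trans hdeg
    rw [Finsupp.sum_fintype _ _ (fun _ => rfl), Fin.sum_univ_three] at this
    exact this
  · intro x y z
    have h := MvPolynomial.eval_eq' ![x, y, z] p
    simp only [Fin.prod_univ_three] at h
    rw [Finset.sum_map]
    simpa [p] using h

/-- The polynomial-method bound for tricoloured sum-free sets in `F ^ k`. -/
theorem card_le_of_tricolored_sum_free {F J : Type*} [Field F] [Fintype F] [Fintype J]
    {m k : ℕ} (hF : Fintype.card F = m + 1) (f₁ f₂ f₃ : J → Fin k → F)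
    (H : ∀ a b c, f₁ a + f₂ b + f₃ c = 0 ↔ a = b ∧ b = c) :
    Fintype.card J ≤ 3 * #(lowExponents m k) := by
  classical
  have hm : m ≠ 0 := by
    have := Fintype.one_lt_card (α := F)
    omega
  obtain ⟨S, C, hS, hC⟩ := exists_three_variable_expansion (F := F) m
  let Ω : Finset (Fin k → Fin 3 → ℕ) := Fintype.piFinset fun _ => S
  let e : Fin 3 → (Fin k → Fin 3 → ℕ) → Fin k → ℕ := fun r P t => P t r
  let mon : (Fin k → F) → (Fin k → ℕ) → F := fun x u => ∏ t, x t ^ u t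
  let K : (Fin k → Fin 3 → ℕ) → F := fun P => ∏ t, C (P t)
  let L := lowExponents m k
  -- The three exponent vectors of a monomial have total degree at most `m * k`, so one of them has
  -- at most a third of it.
  have hlow : ∀ P ∈ Ω, e 0 P ∈ L ∨ e 1 P ∈ L ∨ e 2 P ∈ L := by
    intro P hP
    have hP' : ∀ t, P t 0 + P t 1 + P t 2 ≤ m := fun t => hS _ (Fintype.mem_piFinset.1 hP t)
    have hbox : ∀ r, e r P ∈ Fintype.piFinset fun _ : Fin k => range (m + 1) := by
      intro r
      refine Fintype.mem_piFinset.2 fun t => Finset.mem_range.2 ?_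
      have := hP' t
      fin_cases r <;> simp [e] <;> omega
    have hsum : ∑ t, P t 0 + ∑ t, P t 1 + ∑ t, P t 2 ≤ m * k := by
      rw [← Finset.sum_add_distrib, ← Finset.sum_add_distrib]
      refine (Finset.sum_le_sum fun t _ => hP' t).trans ?_
      simp [mul_comm]
    by_contra! h
    simp only [L, lowExponents, Finset.mem_filter, hbox, true_and, not_le, e] at h
    omega
  have hexp : ∀ a b c, (if a = b ∧ b = c then (1 : F) else 0) =
      ∑ P ∈ Ω, K P * (mon (f₁ a) (e 0 P) * mon (f₂ b) (e 1 P) * mon (f₃ c) (e 2 P)) := by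
    intro a b c
    -- Since `m = |F| - 1`, the factor `1 - x ^ m` is the indicator of `x = 0`.
    have h1 : (if a = b ∧ b = c then (1 : F) else 0) =
        ∏ t, (1 - (f₁ a t + f₂ b t + f₃ c t) ^ m) := by
      split_ifs with h
      · refine (Finset.prod_eq_one fun t _ => ?_).symm
        have := congrFun ((H a b c).2 h) t
        simp only [Pi.add_apply, Pi.zero_apply] at this
        rw [this, zero_pow hm, sub_zero]
      · have : ∃ t, f₁ a t + f₂ b t + f₃ c t ≠ 0 := by
          by_contra! h'
          exact h ((H a b c).1 (funext h'))
        obtain ⟨t, ht⟩ := this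
        refine (Finset.prod_eq_zero (Finset.mem_univ t) ?_).symm
        have := FiniteField.pow_card_sub_one_eq_one _ ht
        rw [hF, Nat.add_sub_cancel] at this
        rw [this, sub_self]
    rw [h1]
    simp_rw [hC]
    rw [Finset.prod_univ_sum]
    refine Finset.sum_congr rfl fun P _ => ?_
    simp only [K, mon, e, Finset.prod_mul_distrib]
  -- Each monomial is charged to the first of its three exponent vectors that is low; grouping by
  -- that vector gives at most `3 * #L` slices.
  let Ω₁ := {P ∈ Ω | e 0 P ∈ L}
  let Ω₂ := {P ∈ {P ∈ Ω | e 0 P ∉ L} | e 1 P ∈ L}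
  let Ω₃ := {P ∈ {P ∈ Ω | e 0 P ∉ L} | e 1 P ∉ L}
  have key := card_le_of_slice_decomposition (F := F) (J := J) (I₁ := L) (I₂ := L) (I₃ := L)
    (fun u a => mon (f₁ a) u)
    (fun u b c => ∑ P ∈ Ω₁ with e 0 P = u, K P * (mon (f₂ b) (e 1 P) * mon (f₃ c) (e 2 P)))
    (fun u b => mon (f₂ b) u)
    (fun u a c => ∑ P ∈ Ω₂ with e 1 P = u, K P * (mon (f₁ a) (e 0 P) * mon (f₃ c) (e 2 P)))
    (fun u c => mon (f₃ c) u)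
    (fun u a b => ∑ P ∈ Ω₃ with e 2 P = u, K P * (mon (f₁ a) (e 0 P) * mon (f₂ b) (e 1 P)))
    (by
      intro a b c
      rw [hexp, ← Finset.sum_filter_add_sum_filter_not Ω (fun P => e 0 P ∈ L),
        ← Finset.sum_filter_add_sum_filter_not {P ∈ Ω | e 0 P ∉ L} (fun P => e 1 P ∈ L),
        ← add_assoc]
      congr 1
      · congr 1
        · rw [← Finset.sum_fiberwise_of_maps_to (s := Ω₁) (t := L) (g := e 0)
            fun P hP => (Finset.mem_filter.1 hP).2, ← Finset.sum_coe_sort]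
          refine Finset.sum_congr rfl fun u _ => ?_
          rw [Finset.mul_sum]
          refine Finset.sum_congr rfl fun P hP => ?_
          rw [(Finset.mem_filter.1 hP).2]; ring
        · rw [← Finset.sum_fiberwise_of_maps_to (s := Ω₂) (t := L) (g := e 1)
            fun P hP => (Finset.mem_filter.1 hP).2, ← Finset.sum_coe_sort]
          refine Finset.sum_congr rfl fun u _ => ?_
          rw [Finset.mul_sum]
          refine Finset.sum_congr rfl fun P hP => ?_
          rw [(Finset.mem_filter.1 hP).2]; ring
      · rw [← Finset.sum_fiberwise_of_maps_to (s := Ω₃) (t := L) (g := e 2)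
            fun P hP => ?_, ← Finset.sum_coe_sort]
        · refine Finset.sum_congr rfl fun u _ => ?_
          rw [Finset.mul_sum]
          refine Finset.sum_congr rfl fun P hP => ?_
          rw [(Finset.mem_filter.1 hP).2]; ring
        · obtain ⟨h1, h2⟩ := Finset.mem_filter.1 hP
          obtain ⟨h3, h4⟩ := Finset.mem_filter.1 h1
          exact ((hlow P h3).resolve_left h4).resolve_left h2)
  simp only [Fintype.card_coe] at key
  change _ ≤ 3 * #L
  omega

/-! ### Random sampling of zero-sum triples -/

/-- The triples in `A` on which the three maps `f r` add up to zero. -/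
def zeroSumTriples {X E : Type*} [AddCommMonoid E] [DecidableEq E] (f : Fin 3 → X → E)
    (A : Finset X) : Finset (Fin 3 → X) :=
  {p ∈ Fintype.piFinset fun _ => A | ∑ r, f r (p r) = 0}

section Sampling

variable {F E X : Type*} [Field F] [Field E] [Fintype E] [DecidableEq E] [Algebra F E]
  [DecidableEq X]

omit [DecidableEq E] in
theorem card_add_mem_submodule (W : Submodule F E) [DecidablePred (· ∈ W)] (x : E) :
    #{u | x + u ∈ W} = Nat.card W := by
  rw [Nat.card_eq_fintype_card, Fintype.card_subtype]
  refine Finset.card_bij (fun u _ => x + u) ?_ ?_ ?_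
  · simp
  · simp
  · intro w hw
    exact ⟨w - x, by simpa using hw, by ring⟩

theorem card_mul_mem_submodule (W : Submodule F E) [DecidablePred (· ∈ W)] {x : E} (hx : x ≠ 0) :
    #{b ∈ ({0}ᶜ : Finset E) | b * x ∈ W} + 1 = Nat.card W := by
  rw [Nat.card_eq_fintype_card, Fintype.card_subtype]
  have h0 : (0 : E) ∈ (univ.filter (· ∈ W)) := by simp
  rw [← Finset.card_erase_add_one h0]
  congr 1
  refine Finset.card_bij (fun b _ => b * x) ?_ ?_ ?_
  · intro b hb
    simpa [hx] using hb
  · intro a _ b _ h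
    exact mul_right_cancel₀ hx h
  · intro w hw
    refine ⟨w / x, ?_, by field_simp⟩
    simpa [hx] using hw

/-- The zero-sum triples that are moved into `W` by the affine maps with parameters `θ`. -/
def sampledTriples (f : Fin 3 → X → E) (A : Finset X) (W : Submodule F E) [DecidablePred (· ∈ W)]
    (θ : E × E × E) : Finset (Fin 3 → X) :=
  {p ∈ zeroSumTriples f A | θ.1 * f 0 (p 0) + θ.2.1 ∈ W ∧ θ.1 * f 1 (p 1) + θ.2.2 ∈ W}

/-- The pairs of distinct sampled triples that share a coordinate. -/
def collidingPairs (f : Fin 3 → X → E) (A : Finset X) (W : Submodule F E) [DecidablePred (· ∈ W)]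
    (θ : E × E × E) : Finset ((Fin 3 → X) × (Fin 3 → X)) :=
  {z ∈ sampledTriples f A W θ ×ˢ sampledTriples f A W θ | z.1 ≠ z.2 ∧ ∃ r, z.1 r = z.2 r}

/-- The sampled triples that share no coordinate with another sampled triple. -/
def isolatedTriples (f : Fin 3 → X → E) (A : Finset X) (W : Submodule F E) [DecidablePred (· ∈ W)]
    (θ : E × E × E) : Finset (Fin 3 → X) :=
  {p ∈ sampledTriples f A W θ | ∀ p' ∈ sampledTriples f A W θ, (∃ r, p r = p' r) → p = p'}

variable (f : Fin 3 → X → E) (A : Finset X) (W : Submodule F E) [DecidablePred (· ∈ W)]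

omit [Fintype E] in
theorem card_sampledTriples_le (θ : E × E × E) :
    #(sampledTriples f A W θ) ≤ #(isolatedTriples f A W θ) + #(collidingPairs f A W θ) := by
  rw [← Finset.card_filter_add_card_filter_not (s := sampledTriples f A W θ)
    (fun p => ∀ p' ∈ sampledTriples f A W θ, (∃ r, p r = p' r) → p = p')]
  refine Nat.add_le_add_left ?_ _
  refine (Finset.card_le_card ?_).trans (Finset.card_image_le (f := Prod.fst))
  intro p hp
  obtain ⟨hp, h⟩ := Finset.mem_filter.1 hp
  push Not at h
  obtain ⟨p', hp', hr, hne⟩ := h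
  exact Finset.mem_image.2
    ⟨(p, p'), Finset.mem_filter.2 ⟨Finset.mem_product.2 ⟨hp, hp'⟩, hne, hr⟩, rfl⟩

omit [DecidableEq X] in
theorem sum_card_sampledTriples :
    ∑ θ ∈ ({0}ᶜ : Finset E) ×ˢ (univ : Finset (E × E)), #(sampledTriples f A W θ) =
      #(zeroSumTriples f A) * ((Fintype.card E - 1) * Nat.card W ^ 2) := by
  simp_rw [sampledTriples, Finset.card_filter]
  rw [Finset.sum_comm, Finset.sum_const_nat]
  intro p _
  rw [Finset.sum_product, Finset.sum_const_nat (m := Nat.card W ^ 2), Finset.card_compl,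
    Finset.card_singleton]
  intro b _
  rw [← Finset.card_filter, ← Finset.univ_product_univ, Finset.filter_product
    (fun u => b * f 0 (p 0) + u ∈ W) (fun v => b * f 1 (p 1) + v ∈ W), Finset.card_product,
    card_add_mem_submodule, card_add_mem_submodule, sq]

/-- If both triples survive, then `b = θ.1` moves a nonzero difference of theirs into `W`: directly
in the coordinates 0 and 1, by the zero sum in the coordinate 2. As `E` is a field, only `Nat.card W
- 1` values `b ≠ 0` do so. -/
theorem card_sampling_both_le (hf : ∀ r, Set.InjOn (f r) A) {p p' : Fin 3 → X}
    (hp : p ∈ zeroSumTriples f A) (hp' : p' ∈ zeroSumTriples f A) (hne : p ≠ p') :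
    #{θ ∈ ({0}ᶜ : Finset E) ×ˢ (univ : Finset (E × E)) |
      p ∈ sampledTriples f A W θ ∧ p' ∈ sampledTriples f A W θ} ≤
      (Nat.card W - 1) * Nat.card W ^ 2 := by
  obtain ⟨hpA, hp0⟩ := Finset.mem_filter.1 hp
  obtain ⟨hpA', hp0'⟩ := Finset.mem_filter.1 hp'
  obtain ⟨r, hr⟩ := Function.ne_iff.1 hne
  have hx : f r (p r) - f r (p' r) ≠ 0 := sub_ne_zero.2 fun h =>
    hr (hf r (Fintype.mem_piFinset.1 hpA r) (Fintype.mem_piFinset.1 hpA' r) h)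
  have hsub : {θ ∈ ({0}ᶜ : Finset E) ×ˢ (univ : Finset (E × E)) |
      p ∈ sampledTriples f A W θ ∧ p' ∈ sampledTriples f A W θ} ⊆
      {b ∈ ({0}ᶜ : Finset E) | b * (f r (p r) - f r (p' r)) ∈ W}.biUnion fun b =>
        (({u | b * f 0 (p 0) + u ∈ W} : Finset E) ×ˢ
          ({v | b * f 1 (p 1) + v ∈ W} : Finset E)).map
          ⟨Prod.mk b, Prod.mk_right_injective b⟩ := by
    rintro ⟨b, u, v⟩ hθ
    simp only [mem_filter, mem_product, mem_univ, and_true, sampledTriples] at hθ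
    obtain ⟨hb, ⟨-, hu, hv⟩, -, hu', hv'⟩ := hθ
    simp only [mem_biUnion, mem_filter, mem_map, mem_product, mem_univ, true_and,
      Function.Embedding.coeFn_mk]
    refine ⟨b, ⟨hb, ?_⟩, (u, v), ⟨hu, hv⟩, rfl⟩
    have h0 := W.sub_mem hu hu'
    have h1 := W.sub_mem hv hv'
    have h2 := W.neg_mem (W.add_mem h0 h1)
    rw [Fin.sum_univ_three] at hp0 hp0'
    fin_cases r
    · convert h0 using 1; simp; ring
    · convert h1 using 1; simp; ring
    · convert h2 using 1
      simp only [Fin.reduceFinMk]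
      linear_combination b * hp0 - b * hp0'
  refine (Finset.card_le_card hsub).trans (Finset.card_biUnion_le.trans ?_)
  simp_rw [Finset.card_map, Finset.card_product, card_add_mem_submodule]
  rw [Finset.sum_const, smul_eq_mul, ← sq]
  have := card_mul_mem_submodule W hx
  exact Nat.mul_le_mul_right _ (by omega)

theorem sum_card_collidingPairs_le (hf : ∀ r, Set.InjOn (f r) A) {D : ℕ}
    (hD : ∀ r, ∀ a ∈ A, #{p ∈ zeroSumTriples f A | p r = a} ≤ D) :
    ∑ θ ∈ ({0}ᶜ : Finset E) ×ˢ (univ : Finset (E × E)), #(collidingPairs f A W θ) ≤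
      #(zeroSumTriples f A) * (3 * D) * ((Nat.card W - 1) * Nat.card W ^ 2) := by
  set T := zeroSumTriples f A with hT
  let Z : Finset ((Fin 3 → X) × (Fin 3 → X)) := {z ∈ T ×ˢ T | z.1 ≠ z.2 ∧ ∃ r, z.1 r = z.2 r}
  have hZ : #Z ≤ #T * (3 * D) := by
    have hsub : Z ⊆ T.biUnion fun p => (univ : Finset (Fin 3)).biUnion fun r =>
        {p' ∈ T | p' r = p r}.map ⟨Prod.mk p, Prod.mk_right_injective p⟩ := by
      rintro ⟨p, p'⟩ hz
      simp only [Z, mem_filter, mem_product] at hz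
      obtain ⟨⟨hp, hp'⟩, -, r, hr⟩ := hz
      simp only [mem_biUnion, mem_map, mem_filter, mem_univ, true_and,
        Function.Embedding.coeFn_mk]
      exact ⟨p, hp, r, p', ⟨hp', hr.symm⟩, rfl⟩
    refine (Finset.card_le_card hsub).trans (Finset.card_biUnion_le_card_mul _ _ _ fun p hp => ?_)
    refine (Finset.card_biUnion_le_card_mul _ _ D fun r _ => ?_).trans (by simp)
    rw [Finset.card_map]
    exact hD r _ (Fintype.mem_piFinset.1 (Finset.mem_filter.1 hp).1 r)
  have hcoll : ∀ θ, #(collidingPairs f A W θ) =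
      ∑ z ∈ Z, if z.1 ∈ sampledTriples f A W θ ∧ z.2 ∈ sampledTriples f A W θ then 1 else 0 := by
    intro θ
    rw [← Finset.card_filter]
    congr 1
    ext z
    simp only [collidingPairs, Z, mem_filter, mem_product]
    have : ∀ p, p ∈ sampledTriples f A W θ → p ∈ T := fun p hp => (Finset.mem_filter.1 hp).1
    constructor
    · rintro ⟨⟨h1, h2⟩, h3⟩
      exact ⟨⟨⟨this _ h1, this _ h2⟩, h3⟩, h1, h2⟩
    · rintro ⟨⟨-, h3⟩, h1, h2⟩
      exact ⟨⟨h1, h2⟩, h3⟩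
  simp_rw [hcoll]
  rw [Finset.sum_comm]
  refine (Finset.sum_le_card_nsmul Z _ ((Nat.card W - 1) * Nat.card W ^ 2) fun z hz => ?_).trans
    (by rw [smul_eq_mul]; exact Nat.mul_le_mul_right _ hZ)
  obtain ⟨h1, h2, -⟩ := Finset.mem_filter.1 hz
  obtain ⟨h3, h4⟩ := Finset.mem_product.1 h1
  rw [← Finset.card_filter]
  exact card_sampling_both_le f A W hf h3 h4 h2

/-- First moment with deletion: by `hDW` the average number of colliding pairs is at most half the
average number of sampled triples, so some `θ` leaves half of that average isolated. -/
theorem exists_card_isolatedTriples (hf : ∀ r, Set.InjOn (f r) A) {D : ℕ}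
    (hD : ∀ r, ∀ a ∈ A, #{p ∈ zeroSumTriples f A | p r = a} ≤ D)
    (hDW : 6 * D * (Nat.card W - 1) ≤ Fintype.card E - 1) :
    ∃ θ : E × E × E, θ.1 ≠ 0 ∧ #(zeroSumTriples f A) * Nat.card W ^ 2 ≤
      2 * Fintype.card E ^ 2 * #(isolatedTriples f A W θ) := by
  by_contra! h
  have h2 := sum_card_sampledTriples f A W
  have h3 := sum_card_collidingPairs_le f A W hf hD
  set T := #(zeroSumTriples f A)
  set Q := Fintype.card E
  set K := Nat.card W
  have hQ : 1 < Q := Fintype.one_lt_card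
  set Θ := ({0}ᶜ : Finset E) ×ˢ (univ : Finset (E × E)) with hΘ
  have hΘc : #Θ = (Q - 1) * Q ^ 2 := by
    rw [hΘ, Finset.card_product, Finset.card_compl, Finset.card_singleton, Finset.card_univ,
      Fintype.card_prod, sq]
  have hΘne : Θ.Nonempty := by
    rw [← Finset.card_pos, hΘc]
    have : 0 < Q - 1 := by omega
    positivity
  have h1 : ∑ θ ∈ Θ, 2 * Q ^ 2 * #(isolatedTriples f A W θ) < #Θ * (T * K ^ 2) := by
    refine (Finset.sum_lt_sum_of_nonempty hΘne fun θ hθ => h θ ?_).trans_eq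
      (Finset.sum_const_nat fun _ _ => rfl)
    simpa [hΘ] using hθ
  have h4 : ∑ θ ∈ Θ, #(sampledTriples f A W θ) ≤
      ∑ θ ∈ Θ, #(isolatedTriples f A W θ) + ∑ θ ∈ Θ, #(collidingPairs f A W θ) := by
    rw [← Finset.sum_add_distrib]
    exact Finset.sum_le_sum fun θ _ => card_sampledTriples_le f A W θ
  rw [← Finset.mul_sum, hΘc] at h1
  set I := ∑ θ ∈ Θ, #(isolatedTriples f A W θ)
  have h5 : 2 * (T * (3 * D) * ((K - 1) * K ^ 2)) ≤ T * ((Q - 1) * K ^ 2) := by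
    calc _ = T * K ^ 2 * (6 * D * (K - 1)) := by ring
      _ ≤ T * K ^ 2 * (Q - 1) := Nat.mul_le_mul_left _ hDW
      _ = _ := by ring
  have h6 : T * ((Q - 1) * K ^ 2) ≤ 2 * I := by linarith
  have h7 : Q ^ 2 * (T * ((Q - 1) * K ^ 2)) ≤ Q ^ 2 * (2 * I) := Nat.mul_le_mul_left _ h6
  linarith

/-- Isolated triples are tricoloured sum-free in `W`: a zero sum mixing `a`, `b`, `c` is again a
sampled triple, and it shares a coordinate with each of the three. -/
theorem card_isolatedTriples_le [Fintype F] {m k : ℕ} (hF : Fintype.card F = m + 1)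
    (hW : Module.finrank F W = k) (θ : E × E × E) (hθ : θ.1 ≠ 0) :
    #(isolatedTriples f A W θ) ≤ 3 * #(lowExponents m k) := by
  have hmem : ∀ a : isolatedTriples f A W θ, a.1 ∈ sampledTriples f A W θ :=
    fun a => (Finset.mem_filter.1 a.2).1
  have hA : ∀ (a : isolatedTriples f A W θ) r, a.1 r ∈ A := fun a =>
    Fintype.mem_piFinset.1 (Finset.mem_filter.1 (Finset.mem_filter.1 (hmem a)).1).1
  have hsum : ∀ a : isolatedTriples f A W θ, f 0 (a.1 0) + f 1 (a.1 1) + f 2 (a.1 2) = 0 := by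
    intro a
    rw [← Fin.sum_univ_three fun r => f r (a.1 r)]
    exact (Finset.mem_filter.1 (Finset.mem_filter.1 (hmem a)).1).2
  let e : W ≃ₗ[F] Fin k → F := (Module.finBasisOfFinrankEq F W hW).equivFun
  let g₀ : isolatedTriples f A W θ → W := fun a =>
    ⟨θ.1 * f 0 (a.1 0) + θ.2.1, (Finset.mem_filter.1 (hmem a)).2.1⟩
  let g₁ : isolatedTriples f A W θ → W := fun a =>
    ⟨θ.1 * f 1 (a.1 1) + θ.2.2, (Finset.mem_filter.1 (hmem a)).2.2⟩
  rw [← Fintype.card_coe]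
  refine card_le_of_tricolored_sum_free hF (e ∘ g₀) (e ∘ g₁) (fun a => - e (g₀ a + g₁ a)) ?_
  intro a b c
  simp only [Function.comp_apply, ← map_add, ← map_neg, map_eq_zero_iff e e.injective]
  have hiff : g₀ a + g₁ b + -(g₀ c + g₁ c) = 0 ↔
      f 0 (a.1 0) + f 1 (b.1 1) + f 2 (c.1 2) = 0 := by
    rw [← Subtype.coe_inj]
    have : ((g₀ a + g₁ b + -(g₀ c + g₁ c) : W) : E) =
        θ.1 * (f 0 (a.1 0) + f 1 (b.1 1) + f 2 (c.1 2)) := by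
      simp only [g₀, g₁, Submodule.coe_add, Submodule.coe_neg]
      linear_combination (- θ.1) * hsum c
    rw [this, Submodule.coe_zero, mul_eq_zero, or_iff_right hθ]
  rw [hiff]
  constructor
  · intro h
    let p : Fin 3 → X := ![a.1 0, b.1 1, c.1 2]
    have hp : p ∈ sampledTriples f A W θ := by
      refine Finset.mem_filter.2 ⟨Finset.mem_filter.2 ⟨Fintype.mem_piFinset.2 fun r => ?_, ?_⟩,
        (g₀ a).2, (g₁ b).2⟩
      · fin_cases r
        exacts [hA a 0, hA b 1, hA c 2]
      · rw [Fin.sum_univ_three]; exact h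
    have ha : a.1 = p := (Finset.mem_filter.1 a.2).2 p hp ⟨0, rfl⟩
    have hb : b.1 = p := (Finset.mem_filter.1 b.2).2 p hp ⟨1, rfl⟩
    have hc : c.1 = p := (Finset.mem_filter.1 c.2).2 p hp ⟨2, rfl⟩
    exact ⟨Subtype.ext (ha.trans hb.symm), Subtype.ext (hb.trans hc.symm)⟩
  · rintro ⟨rfl, rfl⟩
    exact hsum a

end Sampling

/-! ### Regularization and supersaturation in finite fields -/

theorem exists_submodule_finrank_eq {F V : Type*} [Field F] [AddCommGroup V] [Module F V]
    [Module.Finite F V] {k : ℕ} (hk : k ≤ Module.finrank F V) :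
    ∃ W : Submodule F V, Module.finrank F W = k := by
  let b := Module.finBasis F V
  refine ⟨Submodule.span F (Set.range (b ∘ Fin.castLE hk)), ?_⟩
  rw [finrank_span_eq_card (b.linearIndependent.comp _ (Fin.castLE_injective hk)),
    Fintype.card_fin]

/-- Among the nonempty subsets of `A` the ratio of `t S` and `|S| ^ κ` has a minimum. -/
theorem exists_subset_minimizing {X : Type*} [DecidableEq X] {A : Finset X} (hA : A.Nonempty)
    (t : Finset X → ℕ) (κ : ℕ) :
    ∃ S ⊆ A, S.Nonempty ∧ ∀ B ⊆ A, B.Nonempty → t S * #B ^ κ ≤ t B * #S ^ κ := by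
  obtain ⟨S, hS, hmin⟩ := Finset.exists_min_image {S ∈ A.powerset | S.Nonempty}
    (fun S => (t S : ℝ) / (#S : ℝ) ^ κ) ⟨A, by simpa using hA⟩
  simp only [mem_filter, mem_powerset] at hS hmin
  refine ⟨S, hS.1, hS.2, fun B hB hB' => ?_⟩
  have h := hmin B ⟨hB, hB'⟩
  have h1 : (0 : ℝ) < #S := by exact_mod_cast hS.2.card_pos
  have h2 : (0 : ℝ) < #B := by exact_mod_cast hB'.card_pos
  rw [div_le_div_iff₀ (by positivity) (by positivity)] at h
  exact_mod_cast h

/-- In a minimizer every element lies in at most `κ` times the average number of triples. -/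
theorem card_mul_card_fiber_le_of_minimizing {X E : Type*} [DecidableEq X] [AddCommMonoid E]
    [DecidableEq E] (f : Fin 3 → X → E) {A S : Finset X} {κ : ℕ} (hκ : 1 ≤ κ) (hSA : S ⊆ A)
    (hmin : ∀ B ⊆ A, B.Nonempty →
      #(zeroSumTriples f S) * #B ^ κ ≤ #(zeroSumTriples f B) * #S ^ κ)
    (r : Fin 3) {a : X} (ha : a ∈ S) :
    #S * #{p ∈ zeroSumTriples f S | p r = a} ≤ κ * #(zeroSumTriples f S) := by
  set T := zeroSumTriples f S with hT
  set d := #{p ∈ T | p r = a} with hd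
  have hdT : d ≤ #T := Finset.card_le_card (Finset.filter_subset _ _)
  have hpos : 0 < #S := Finset.card_pos.2 ⟨a, ha⟩
  obtain h1 | h1 : #S = 1 ∨ 1 < #S := by omega
  -- A singleton is treated apart, because minimality compares `S` with nonempty sets only.
  · rw [h1, one_mul]
    nlinarith
  have hne : (S.erase a).Nonempty := by
    rw [← Finset.card_pos, Finset.card_erase_of_mem ha]
    omega
  have h2 := hmin (S.erase a) ((Finset.erase_subset _ _).trans hSA) hne
  have h3 : #(zeroSumTriples f (S.erase a)) + d ≤ #T := by
    rw [hd, ← Finset.card_filter_add_card_filter_not (s := T) (fun p => p r = a), add_comm]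
    refine Nat.add_le_add_left (Finset.card_le_card fun p hp => ?_) _
    obtain ⟨hp1, hp2⟩ := Finset.mem_filter.1 hp
    have hp3 := Fintype.mem_piFinset.1 hp1
    refine Finset.mem_filter.2 ⟨Finset.mem_filter.2 ⟨Fintype.mem_piFinset.2 fun i =>
      Finset.mem_of_mem_erase (hp3 i), hp2⟩, Finset.ne_of_mem_erase (hp3 r)⟩
  rw [Finset.card_erase_of_mem ha] at h2
  set M := #S
  have hM : (0 : ℝ) < M := by positivity
  have h4 : (#T : ℝ) * (M - 1) ^ κ ≤ (#T - d) * M ^ κ := by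
    have h5 : #T * (M - 1) ^ κ ≤ (#T - d) * M ^ κ :=
      h2.trans (Nat.mul_le_mul_right _ (by omega))
    have h6 : ((#T * (M - 1) ^ κ : ℕ) : ℝ) ≤ (((#T - d) * M ^ κ : ℕ) : ℝ) := by exact_mod_cast h5
    push_cast [Nat.cast_sub hdT, Nat.cast_sub (show 1 ≤ M by omega)] at h6
    exact h6
  -- Bernoulli's inequality turns the minimality against `S.erase a` into a linear bound on `d`.
  have hb : 1 - (κ : ℝ) / M ≤ (1 - 1 / M) ^ κ := by
    have := one_add_mul_le_pow (a := -(1 / (M : ℝ))) (by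
      have : 1 / (M : ℝ) ≤ 1 := by
        rw [div_le_one hM]; exact_mod_cast h1.le
      linarith) κ
    calc 1 - (κ : ℝ) / M = 1 + κ * -(1 / (M : ℝ)) := by ring
      _ ≤ _ := this
      _ = _ := by ring
  have h7 : (#T : ℝ) * (1 - κ / M) ≤ #T - d := by
    have h8 : (M - 1 : ℝ) = M * (1 - 1 / M) := by field_simp
    rw [h8, mul_pow] at h4
    have h9 : (#T : ℝ) * (1 - 1 / M) ^ κ ≤ #T - d := by
      refine le_of_mul_le_mul_right ?_ (show (0 : ℝ) < M ^ κ by positivity)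
      linarith
    exact (mul_le_mul_of_nonneg_left hb (by positivity)).trans h9
  have h10 : (d : ℝ) ≤ #T * (κ / M) := by linarith
  have h11 : (M : ℝ) * d ≤ κ * #T := by
    calc (M : ℝ) * d ≤ M * (#T * (κ / M)) := by gcongr
      _ = _ := by field_simp
  exact_mod_cast h11

/-- The fibre bound allows sampling with `D ≈ κ T / M`. The dimension `k` is taken as large as the
sampling permits, and the saving for low exponents then forces `T` to be large. -/
theorem card_pow_le_of_card_fiber_le {F E X : Type*} [Field F] [Fintype F] [Field E] [Fintype E]
    [DecidableEq E] [Algebra F E] [DecidableEq X] {m j κ : ℕ}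
    (hj : ∀ k : ℕ, #(lowExponents m k) ^ (j + 1) ≤ ((m + 1) ^ k) ^ j)
    (hF : Fintype.card F = m + 1) (f : Fin 3 → X → E) {S : Finset X} (hS : S.Nonempty)
    (hf : ∀ r, Set.InjOn (f r) S) (hdiag : ∀ a ∈ S, ∑ r, f r a = 0) (hκ : 1 ≤ κ)
    (hfib : ∀ r, ∀ a ∈ S, #S * #{p ∈ zeroSumTriples f S | p r = a} ≤ κ * #(zeroSumTriples f S)) :
    #S ^ (j + 2) ≤ (6 * (m + 1) * κ) ^ (j + 2) * 6 ^ (j + 1) * #(zeroSumTriples f S) *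
      Fintype.card E ^ j := by
  classical
  set T := #(zeroSumTriples f S) with hT
  set M := #S with hM
  set Q := Fintype.card E with hQ
  have hM0 : 0 < M := hS.card_pos
  have hMT : M ≤ T := by
    refine Finset.card_le_card_of_injOn (fun a _ => a) (fun a ha => ?_) fun a _ b _ h => congrFun h 0
    exact Finset.mem_filter.2 ⟨Fintype.mem_piFinset.2 fun _ => ha, hdiag a ha⟩
  have hMQ : M ≤ Q := by
    rw [hQ, ← Finset.card_univ]
    exact Finset.card_le_card_of_injOn (f 0) (fun _ _ => Finset.mem_univ _) (hf 0)
  set D := κ * T / M with hD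
  have hD1 : 1 ≤ D := (Nat.one_le_div_iff hM0).2 (by nlinarith)
  have hMD : M * D ≤ κ * T := Nat.mul_div_le _ _
  have hDfib : ∀ r, ∀ a ∈ S, #{p ∈ zeroSumTriples f S | p r = a} ≤ D := fun r a ha =>
    (Nat.le_div_iff_mul_le hM0).2 (by rw [mul_comm]; exact hfib r a ha)
  set n := Module.finrank F E
  have hQn : Q = (m + 1) ^ n := by rw [hQ, Module.card_eq_pow_finrank (K := F), hF]
  have hc : 1 ≤ 6 * (m + 1) * κ := by
    have := Nat.mul_le_mul (show 1 ≤ 6 * (m + 1) by omega) hκ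
    simpa using this
  -- If `Q < 6 * D`, no subspace is needed: `T` is already of order `M * Q`.
  rcases lt_or_ge Q (6 * D) with hlt | hge
  · have h1 : M * Q ≤ 6 * (m + 1) * κ * T := by
      calc M * Q ≤ M * (6 * D) := Nat.mul_le_mul_left _ hlt.le
        _ = 6 * (M * D) := by ring
        _ ≤ 6 * (κ * T) := Nat.mul_le_mul_left _ hMD
        _ = 6 * 1 * κ * T := by ring
        _ ≤ 6 * (m + 1) * κ * T := by gcongr; omega
    calc M ^ (j + 2) = M ^ j * (M * M) := by ring
      _ ≤ Q ^ j * (M * Q) := by gcongr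
      _ ≤ Q ^ j * (6 * (m + 1) * κ * T) := by gcongr
      _ = (6 * (m + 1) * κ) ^ 1 * 1 * T * Q ^ j := by ring
      _ ≤ _ := by
        gcongr
        · omega
        · exact Nat.one_le_pow _ _ (by norm_num)
  · set k := Nat.findGreatest (fun k => 6 * D * (m + 1) ^ k ≤ Q) n with hk
    have hkn : k ≤ n := Nat.findGreatest_le n
    have hkD : 6 * D * (m + 1) ^ k ≤ Q :=
      Nat.findGreatest_spec (P := fun k => 6 * D * (m + 1) ^ k ≤ Q) (Nat.zero_le n) (by simpa using hge)
    set K := (m + 1) ^ k with hK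
    have hK0 : 0 < K := by positivity
    -- Maximality of `k`; for `k = n` one has `K = Q`, and `D ≥ 1` is enough.
    have hkQ : Q ≤ 6 * D * ((m + 1) * K) := by
      by_contra! h
      have h1 : k + 1 ≤ n := by
        by_contra! h2
        have h3 : k = n := by omega
        have h4 : K = Q := by rw [hK, h3, hQn]
        rw [h4] at h
        nlinarith [Nat.mul_le_mul hD1 (show 1 ≤ m + 1 by omega), Fintype.card_pos (α := E)]
      have h5 : 6 * D * (m + 1) ^ (k + 1) ≤ Q := by rw [pow_succ']; exact h.le
      exact Nat.findGreatest_is_greatest (Nat.lt_succ_self k) h1 h5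
    obtain ⟨W, hW⟩ := exists_submodule_finrank_eq (F := F) (V := E) hkn
    have hWc : Nat.card W = K := by
      rw [Module.natCard_eq_pow_finrank (K := F), hW, Nat.card_eq_fintype_card, hF]
    obtain ⟨θ, hθ, hθT⟩ := exists_card_isolatedTriples f S W hf hDfib (by
      rw [hWc, Nat.mul_sub]
      have : 1 ≤ 6 * D * 1 := by omega
      omega)
    rw [hWc] at hθT
    have hiso := card_isolatedTriples_le f S W hF hW θ hθ
    set L := #(lowExponents m k)
    have h1 : T * K ^ 2 ≤ 6 * Q ^ 2 * L := by
      calc T * K ^ 2 ≤ 2 * Q ^ 2 * _ := hθT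
        _ ≤ 2 * Q ^ 2 * (3 * L) := Nat.mul_le_mul_left _ hiso
        _ = _ := by ring
    have h2 : T ^ (j + 1) * K ^ (j + 2) ≤ 6 ^ (j + 1) * Q ^ (2 * (j + 1)) := by
      refine Nat.le_of_mul_le_mul_right ?_ (show 0 < K ^ j by positivity)
      calc T ^ (j + 1) * K ^ (j + 2) * K ^ j = (T * K ^ 2) ^ (j + 1) := by ring
        _ ≤ (6 * Q ^ 2 * L) ^ (j + 1) := by gcongr
        _ = 6 ^ (j + 1) * Q ^ (2 * (j + 1)) * L ^ (j + 1) := by ring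
        _ ≤ _ := Nat.mul_le_mul_left _ (hj k)
    have h3 : M * Q ≤ 6 * (m + 1) * κ * (T * K) := by
      calc M * Q ≤ M * (6 * D * ((m + 1) * K)) := Nat.mul_le_mul_left _ hkQ
        _ = 6 * (m + 1) * K * (M * D) := by ring
        _ ≤ 6 * (m + 1) * K * (κ * T) := Nat.mul_le_mul_left _ hMD
        _ = _ := by ring
    refine Nat.le_of_mul_le_mul_right ?_ (show 0 < Q ^ (j + 2) from pow_pos Fintype.card_pos _)
    calc M ^ (j + 2) * Q ^ (j + 2) = (M * Q) ^ (j + 2) := by ring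
      _ ≤ (6 * (m + 1) * κ * (T * K)) ^ (j + 2) := by gcongr
      _ = (6 * (m + 1) * κ) ^ (j + 2) * T * (T ^ (j + 1) * K ^ (j + 2)) := by
        generalize 6 * (m + 1) * κ = c
        ring
      _ ≤ (6 * (m + 1) * κ) ^ (j + 2) * T * (6 ^ (j + 1) * Q ^ (2 * (j + 1))) := by gcongr
      _ = _ := by ring

/-- Polynomial supersaturation for zero-sum triples in finite fields of order a power of `m + 1`. -/
theorem exists_card_pow_le_card_zeroSumTriples (m : ℕ) (hm : 1 ≤ m) :
    ∃ j C : ℕ, ∀ (F E X : Type*) [Field F] [Fintype F] [Field E] [Fintype E] [DecidableEq E]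
      [Algebra F E] [DecidableEq X], Fintype.card F = m + 1 →
      ∀ (f : Fin 3 → X → E) (A : Finset X), (∀ r, Set.InjOn (f r) A) →
      (∀ a ∈ A, ∑ r, f r a = 0) →
      #A ^ (j + 2) ≤ C * #(zeroSumTriples f A) * Fintype.card E ^ j := by
  obtain ⟨j, hj⟩ := exists_card_lowExponents_pow_le m hm
  refine ⟨j, (6 * (m + 1) * (j + 2)) ^ (j + 2) * 6 ^ (j + 1), ?_⟩
  intro F E X _ _ _ _ _ _ _ hF f A hf hdiag
  rcases A.eq_empty_or_nonempty with rfl | hA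
  · simp
  -- The exponent `j + 2` is that of the target inequality, so minimality transfers the bound from
  -- `S` to `A` without loss.
  obtain ⟨S, hSA, hS, hmin⟩ := exists_subset_minimizing hA (fun S => #(zeroSumTriples f S)) (j + 2)
  have h := card_pow_le_of_card_fiber_le hj hF f hS (fun r => (hf r).mono (by exact_mod_cast hSA))
    (fun a ha => hdiag a (hSA ha)) (show 1 ≤ j + 2 by omega)
    (fun r a ha => card_mul_card_fiber_le_of_minimizing f (by omega) hSA hmin r ha)
  have h' := hmin A subset_rfl hA
  set C := (6 * (m + 1) * (j + 2)) ^ (j + 2) * 6 ^ (j + 1)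
  refine Nat.le_of_mul_le_mul_right ?_ (show 0 < #S ^ (j + 2) from pow_pos hS.card_pos _)
  calc #A ^ (j + 2) * #S ^ (j + 2)
      ≤ #A ^ (j + 2) * (C * #(zeroSumTriples f S) * Fintype.card E ^ j) := by gcongr
    _ = C * Fintype.card E ^ j * (#(zeroSumTriples f S) * #A ^ (j + 2)) := by ring
    _ ≤ C * Fintype.card E ^ j * (#(zeroSumTriples f A) * #S ^ (j + 2)) := by gcongr
    _ = _ := by ring

/-! ### Equations over F_q[t] and the case of three variables -/

/-- The solutions of `∑ i, c i * x i = 0` with all variables in the finite set `A`. -/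
def zeroSums {R : Type*} [CommRing R] [DecidableEq R] {s : ℕ} (c : Fin s → R) (A : Finset R) :
    Finset (Fin s → R) :=
  {x ∈ Fintype.piFinset fun _ => A | ∑ i, c i * x i = 0}

theorem mem_zeroSums {R : Type*} [CommRing R] [DecidableEq R] {s : ℕ} {c : Fin s → R}
    {A : Finset R} {x : Fin s → R} :
    x ∈ zeroSums c A ↔ (∀ i, x i ∈ A) ∧ ∑ i, c i * x i = 0 := by
  simp [zeroSums]

theorem card_zeroSums_comp_perm {R : Type*} [CommRing R] [DecidableEq R] {s : ℕ} (c : Fin s → R)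
    (A : Finset R) (σ : Equiv.Perm (Fin s)) : #(zeroSums (c ∘ σ) A) = #(zeroSums c A) := by
  refine Finset.card_bij' (fun x _ => x ∘ σ.symm) (fun x _ => x ∘ σ) ?_ ?_ ?_ ?_
  · intro x hx
    rw [mem_zeroSums] at hx ⊢
    refine ⟨fun i => hx.1 _, ?_⟩
    rw [← hx.2, ← Equiv.sum_comp σ]
    simp
  · intro x hx
    rw [mem_zeroSums] at hx ⊢
    refine ⟨fun i => hx.1 _, ?_⟩
    rw [← hx.2, ← Equiv.sum_comp σ (fun i => c i * x i)]
    simp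
  · intro x _; ext; simp
  · intro x _; ext; simp

theorem exists_perm_map_pair {s : ℕ} {i j : Fin (s + 2)} (hij : i ≠ j) :
    ∃ σ : Equiv.Perm (Fin (s + 2)), σ 0 = i ∧ σ 1 = j := by
  refine ⟨(Equiv.swap 1 (Equiv.swap 0 i j)).trans (Equiv.swap 0 i), ?_, ?_⟩
  · have h : Equiv.swap 0 i j ≠ 0 := by
      intro h
      rw [Equiv.swap_apply_eq_iff, Equiv.swap_apply_left] at h
      exact hij h.symm
    rw [Equiv.trans_apply, Equiv.swap_apply_of_ne_of_ne (by simp) h.symm, Equiv.swap_apply_left]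
  · rw [Equiv.trans_apply, Equiv.swap_apply_left, Equiv.swap_apply_self]

theorem natCard_degreeLT {F : Type*} [Field F] [Fintype F] (N : ℕ) :
    Nat.card (Polynomial.degreeLT F N) = Fintype.card F ^ N := by
  rw [Nat.card_congr (Polynomial.degreeLTEquiv F N).toEquiv]
  simp

theorem card_le_of_degree_lt {F : Type*} [Field F] [Fintype F] {N : ℕ} {A : Finset F[X]}
    (hA : ∀ x ∈ A, x.degree < N) : #A ≤ Fintype.card F ^ N := by
  have : Finite (Polynomial.degreeLT F N) := Finite.of_equiv _ (Polynomial.degreeLTEquiv F N).symm.toEquiv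
  rw [← natCard_degreeLT, ← Fintype.card_coe, ← Nat.card_eq_fintype_card]
  exact Nat.card_le_card_of_injective
    (fun x : A => (⟨x, Polynomial.mem_degreeLT.2 (hA x x.2)⟩ : Polynomial.degreeLT F N))
    fun x y h => Subtype.ext (congrArg (fun z : Polynomial.degreeLT F N => (z : F[X])) h)

/-- The count of solutions in sets of density `α` is at least `K⁻¹ α ^ κ` times the trivial bound,
for all equations in `s` variables with coefficients of degree at most `ℓ` adding up to zero. -/
def PolynomialSupersaturation (F : Type*) [Field F] [Fintype F] (s ℓ κ K : ℕ) : Prop :=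
  ∀ [DecidableEq F[X]] (c : Fin s → F[X]), (∀ i, c i ≠ 0) → (∀ i, (c i).natDegree ≤ ℓ) →
    ∑ i, c i = 0 → ∀ (N : ℕ) (A : Finset F[X]), A.Nonempty → (∀ x ∈ A, x.degree < N) →
    #A ^ κ * (Fintype.card F ^ N) ^ (s - 1) ≤ K * #(zeroSums c A) * (Fintype.card F ^ N) ^ κ

theorem degree_mul_lt_of_natDegree_le {F : Type*} [Field F] {c x : F[X]} {ℓ N : ℕ}
    (hc : c.natDegree ≤ ℓ) (hx : x.degree < N) : (c * x).degree < ((N + ℓ + 1 : ℕ) : WithBot ℕ) := by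
  rcases eq_or_ne (c * x) 0 with h | h
  · rw [h, Polynomial.degree_zero]; exact WithBot.bot_lt_coe _
  · rw [← Polynomial.natDegree_lt_iff_degree_lt h]
    rw [← Polynomial.natDegree_lt_iff_degree_lt (right_ne_zero_of_mul h)] at hx
    have := Polynomial.natDegree_mul_le (p := c) (q := x)
    omega

theorem exists_linearMap_injOn_degree_lt (F E : Type*) [Field F] [Field E] [Algebra F E] {n : ℕ}
    [Module.Finite F E] (hE : Module.finrank F E = n) :
    ∃ φ : F[X] →ₗ[F] E, ∀ p : F[X], p.degree < n → φ p = 0 → p = 0 := by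
  let e : E ≃ₗ[F] Fin n → F := (Module.finBasisOfFinrankEq F E hE).equivFun
  refine ⟨e.symm.toLinearMap.comp (LinearMap.pi fun i : Fin n => Polynomial.lcoeff F i), ?_⟩
  intro p hp h
  rw [LinearMap.comp_apply, LinearEquiv.coe_coe, map_eq_zero_iff _ e.symm.injective] at h
  ext i
  rw [Polynomial.coeff_zero]
  rcases lt_or_ge i n with hi | hi
  · exact congrFun h ⟨i, hi⟩
  · exact Polynomial.coeff_eq_zero_of_degree_lt (hp.trans_le (by exact_mod_cast hi))

theorem exists_finite_extension (F : Type*) [Field F] [Fintype F] (n : ℕ) [NeZero n] :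
    ∃ (E : Type) (_ : Field E) (_ : Fintype E) (_ : Algebra F E), Module.finrank F E = n := by
  obtain ⟨p, hp⟩ := CharP.exists F
  have : Fact p.Prime := ⟨CharP.char_is_prime F p⟩
  have : Finite (FiniteField.Extension F p n) := Module.finite_of_finite F
  exact ⟨FiniteField.Extension F p n, inferInstance, Fintype.ofFinite _, inferInstance,
    FiniteField.finrank_extension F p n⟩

theorem exists_supersaturation_three (q ℓ : ℕ) :
    ∃ κ K : ℕ, ∀ (F : Type*) [Field F] [Fintype F], Fintype.card F = q →
      PolynomialSupersaturation F 3 ℓ κ K := by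
  rcases lt_or_ge q 2 with hq | hq
  · refine ⟨0, 0, fun F _ _ hF => ?_⟩
    have := Fintype.one_lt_card (α := F)
    omega
  obtain ⟨m, rfl⟩ : ∃ m, q = m + 1 := ⟨q - 1, by omega⟩
  obtain ⟨j, C, hC⟩ := exists_card_pow_le_card_zeroSumTriples m (by omega)
  refine ⟨j + 2, C * ((m + 1) ^ (ℓ + 1)) ^ j, ?_⟩
  intro F _ _ hF _ c hc0 hcℓ hsum N A _ hA
  classical
  -- The products `c r * x` have degree below `N + ℓ`; the extra 1 keeps the extension degree
  -- positive. The map `φ` is merely linear, as multiplication by `c r` precedes it.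
  obtain ⟨E, _, _, _, hE⟩ := exists_finite_extension F (N + ℓ + 1)
  obtain ⟨φ, hφ⟩ := exists_linearMap_injOn_degree_lt F E hE
  have hQ : Fintype.card E = (m + 1) ^ (ℓ + 1) * (m + 1) ^ N := by
    rw [Module.card_eq_pow_finrank (K := F), hE, hF]; ring
  have h := hC F E F[X] hF (fun r x => φ (c r * x)) A ?_ ?_
  · have hle : #(zeroSumTriples (fun r x => φ (c r * x)) A) ≤ #(zeroSums c A) := by
      refine Finset.card_le_card fun x hx => ?_
      obtain ⟨hx1, hx2⟩ := Finset.mem_filter.1 hx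
      have hx3 := Fintype.mem_piFinset.1 hx1
      refine Finset.mem_filter.2 ⟨hx1, hφ _ ?_ (by rw [map_sum]; exact hx2)⟩
      rw [← Polynomial.mem_degreeLT]
      exact Submodule.sum_mem _ fun r _ => Polynomial.mem_degreeLT.2
        (degree_mul_lt_of_natDegree_le (hcℓ r) (hA _ (hx3 r)))
    rw [hF]
    set G := (m + 1) ^ N
    rw [hQ] at h
    calc #A ^ (j + 2) * G ^ 2 ≤ C * #(zeroSumTriples (fun r x => φ (c r * x)) A) *
          ((m + 1) ^ (ℓ + 1) * G) ^ j * G ^ 2 := Nat.mul_le_mul_right _ h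
      _ ≤ C * #(zeroSums c A) * ((m + 1) ^ (ℓ + 1) * G) ^ j * G ^ 2 := by gcongr
      _ = _ := by rw [mul_pow]; ring
  · intro r x hx y hy hxy
    have hdeg : (x - y).degree < N := (Polynomial.degree_sub_le _ _).trans_lt
      (max_lt (hA x hx) (hA y hy))
    have h0 := hφ (c r * (x - y)) (degree_mul_lt_of_natDegree_le (hcℓ r) hdeg) (by
      rw [mul_sub, map_sub, sub_eq_zero]; exact hxy)
    exact sub_eq_zero.1 ((mul_eq_zero.1 h0).resolve_left (hc0 r))
  · intro a _
    rw [← map_sum, ← Finset.sum_mul, hsum, zero_mul, map_zero]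

/-! ### Induction on the number of variables -/

/-- If a pair of coefficients has a nonzero sum, the equation splits into one in three variables
and one in one variable less. -/
theorem supersaturation_of_add_ne_zero {F : Type*} [Field F] [Fintype F] [DecidableEq F[X]]
    {s ℓ κ K κ₃ K₃ : ℕ} (h₃ : PolynomialSupersaturation F 3 ℓ κ₃ K₃)
    (h : PolynomialSupersaturation F (s + 1) ℓ κ K) {c : Fin (s + 2) → F[X]} (hc0 : ∀ i, c i ≠ 0)
    (hcℓ : ∀ i, (c i).natDegree ≤ ℓ) (hsum : ∑ i, c i = 0) (hpair : c 0 + c 1 ≠ 0) {N : ℕ}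
    {A : Finset F[X]} (hAne : A.Nonempty) (hA : ∀ x ∈ A, x.degree < N) :
    #A ^ (κ + κ₃) * (Fintype.card F ^ N) ^ (s + 1) ≤
      2 ^ (κ + κ₃) * K₃ * K * #(zeroSums c A) * (Fintype.card F ^ N) ^ (κ + κ₃) := by
  set G := Fintype.card F ^ N with hG
  have hG0 : 0 < G := pow_pos Fintype.card_pos _
  set c' : Fin s → F[X] := fun i => c i.succ.succ with hc'
  set e := c 0 + c 1 with he
  have heℓ : e.natDegree ≤ ℓ := (Polynomial.natDegree_add_le _ _).trans (max_le (hcℓ _) (hcℓ _))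
  have hsum' : c 0 + (c 1 + ∑ i, c' i) = 0 := by
    rw [← hsum, Fin.sum_univ_succ, Fin.sum_univ_succ]; rfl
  let R : F[X] → Finset (Fin s → F[X]) := fun y =>
    {x ∈ Fintype.piFinset fun _ => A | e * y + ∑ i, c' i * x i = 0}
  -- The values `y` with few completions. Were `B` half of `A`, the shorter equation would have too
  -- many solutions inside `B`: the factor 2 pays for halving, the last `G` for the number of
  -- choices of `y`.
  let B := {y ∈ A | K * (2 * G) ^ κ * G * #(R y) < #A ^ κ * G ^ s}
  have hB : 2 * #B < #A := by
    by_contra! hBA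
    have hBA' : B ⊆ A := Finset.filter_subset _ _
    have hBne : B.Nonempty := by
      rw [← Finset.card_pos]
      have := hAne.card_pos
      omega
    have h1 := h (Fin.cons e c') (Fin.cases hpair fun i => hc0 _) (Fin.cases heℓ fun i => hcℓ _)
      (by rw [Fin.sum_univ_succ]; simp only [Fin.cons_zero, Fin.cons_succ]
          rw [← hsum', he, add_assoc]) N B hBne fun x hx => hA x (hBA' hx)
    rw [Nat.add_sub_cancel] at h1
    have h2 : #(zeroSums (Fin.cons e c' : Fin (s + 1) → F[X]) B) ≤ ∑ y ∈ B, #(R y) := by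
      rw [← Finset.card_sigma]
      refine Finset.card_le_card_of_injOn (fun x => ⟨x 0, Fin.tail x⟩) ?_ ?_
      · intro x hx
        rw [Finset.mem_coe, mem_zeroSums, Fin.sum_univ_succ] at hx
        simp only [coe_sigma, Set.mem_sigma_iff, Finset.mem_coe]
        exact ⟨hx.1 0, Finset.mem_filter.2
          ⟨Fintype.mem_piFinset.2 fun i => hBA' (hx.1 i.succ), by simpa [Fin.tail] using hx.2⟩⟩
      · intro x _ y _ hxy
        simp only [Sigma.mk.injEq, heq_eq_eq] at hxy
        rw [← Fin.cons_self_tail x, ← Fin.cons_self_tail y, hxy.1, hxy.2]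
    have hBG : #B ≤ G := card_le_of_degree_lt fun x hx => hA x (hBA' hx)
    have h3 : ∑ y ∈ B, K * (2 * G) ^ κ * G * #(R y) < #B * (#A ^ κ * G ^ s) :=
      (Finset.sum_lt_sum_of_nonempty hBne fun y hy => (Finset.mem_filter.1 hy).2).trans_eq
        (Finset.sum_const_nat fun _ _ => rfl)
    rw [← Finset.mul_sum] at h3
    have h4 : #A ^ κ * G ^ s ≤ K * (2 * G) ^ κ * ∑ y ∈ B, #(R y) := by
      calc #A ^ κ * G ^ s ≤ (2 * #B) ^ κ * G ^ s := by gcongr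
        _ = 2 ^ κ * (#B ^ κ * G ^ s) := by ring
        _ ≤ 2 ^ κ * (K * #(zeroSums (Fin.cons e c' : Fin (s + 1) → F[X]) B) * G ^ κ) := by gcongr
        _ ≤ 2 ^ κ * (K * (∑ y ∈ B, #(R y)) * G ^ κ) := by gcongr
        _ = _ := by ring
    have h5 : #B * (#A ^ κ * G ^ s) ≤ G * (K * (2 * G) ^ κ * ∑ y ∈ B, #(R y)) :=
      Nat.mul_le_mul hBG h4
    linarith
  set A' := A \ B with hA'
  have hA'A : A' ⊆ A := Finset.sdiff_subset
  have hcard : #A ≤ 2 * #A' := by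
    have : #A' + #B = #A := Finset.card_sdiff_add_card_eq_card (Finset.filter_subset _ _)
    omega
  have hA'ne : A'.Nonempty := by
    rw [← Finset.card_pos]
    have := hAne.card_pos
    omega
  -- Each triple with `c 0 * x + c 1 * y = e * z` in `A'` extends by every completion of `z`, of
  -- which there are many.
  have h1 := h₃ ![c 0, c 1, -e] (by intro i; fin_cases i; exacts [hc0 0, hc0 1, neg_ne_zero.2 hpair])
    (by intro i; fin_cases i; exacts [hcℓ 0, hcℓ 1, (Polynomial.natDegree_neg e).trans_le heℓ])
    (by simp [Fin.sum_univ_three, he]) N A' hA'ne fun x hx => hA x (hA'A hx)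
  set T := zeroSums ![c 0, c 1, -e] A' with hT
  have h2 : ∑ p ∈ T, #(R (p 2)) ≤ #(zeroSums c A) := by
    rw [← Finset.card_sigma]
    have hTe : ∀ p ∈ T, c 0 * p 0 + c 1 * p 1 = e * p 2 := by
      intro p hp
      have := (mem_zeroSums.1 hp).2
      simp only [Fin.sum_univ_three, Matrix.cons_val] at this
      linear_combination this
    refine Finset.card_le_card_of_injOn (fun z => Fin.cons (z.1 0) (Fin.cons (z.1 1) z.2)) ?_ ?_
    · rintro ⟨p, x⟩ hz
      obtain ⟨hp, hx⟩ := Finset.mem_sigma.1 (Finset.mem_coe.1 hz)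
      obtain ⟨hx1, hx2⟩ := Finset.mem_filter.1 hx
      have hpA := (mem_zeroSums.1 hp).1
      refine mem_zeroSums.2 ⟨Fin.cases (hA'A (hpA 0)) (Fin.cases (hA'A (hpA 1))
        (Fintype.mem_piFinset.1 hx1)), ?_⟩
      rw [Fin.sum_univ_succ, Fin.sum_univ_succ]
      simp only [Fin.cons_zero, Fin.cons_succ]
      refine Eq.trans ?_ hx2
      rw [← hTe p hp]
      exact (add_assoc (c 0 * p 0) (c 1 * p 1) (∑ i, c' i * x i)).symm
    · rintro ⟨p, x⟩ hz ⟨p', x'⟩ hz' hpp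
      have hp := hTe p (Finset.mem_sigma.1 (Finset.mem_coe.1 hz)).1
      have hp' := hTe p' (Finset.mem_sigma.1 (Finset.mem_coe.1 hz')).1
      obtain ⟨e0, hpp⟩ := Fin.cons_inj.1 hpp
      obtain ⟨e1, e2⟩ := Fin.cons_inj.1 hpp
      simp only at e0 e1 e2
      -- The glued variable is not recorded in the solution, but `e ≠ 0` recovers it from the first
      -- two.
      have e3 : p 2 = p' 2 := mul_left_cancel₀ hpair (by rw [← hp, ← hp', e0, e1])
      have : p = p' := by
        ext1 r
        fin_cases r
        exacts [e0, e1, e3]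
      rw [this, e2]
  have h3 : #T * (#A ^ κ * G ^ s) ≤ K * (2 * G) ^ κ * G * #(zeroSums c A) := by
    refine le_trans ?_ (Nat.mul_le_mul_left _ h2)
    rw [Finset.mul_sum]
    refine Finset.card_nsmul_le_sum _ _ _ fun p hp => ?_
    have hp2 := Finset.mem_sdiff.1 ((mem_zeroSums.1 hp).1 2)
    by_contra! hlt
    exact hp2.2 (Finset.mem_filter.2 ⟨hp2.1, hlt⟩)
  refine Nat.le_of_mul_le_mul_right ?_ hG0
  calc #A ^ (κ + κ₃) * G ^ (s + 1) * G = #A ^ κ₃ * G ^ 2 * (#A ^ κ * G ^ s) := by ring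
    _ ≤ (2 * #A') ^ κ₃ * G ^ 2 * (#A ^ κ * G ^ s) := by gcongr
    _ = 2 ^ κ₃ * (#A' ^ κ₃ * G ^ 2) * (#A ^ κ * G ^ s) := by ring
    _ ≤ 2 ^ κ₃ * (K₃ * #T * G ^ κ₃) * (#A ^ κ * G ^ s) := by gcongr
    _ = 2 ^ κ₃ * K₃ * G ^ κ₃ * (#T * (#A ^ κ * G ^ s)) := by ring
    _ ≤ 2 ^ κ₃ * K₃ * G ^ κ₃ * (K * (2 * G) ^ κ * G * #(zeroSums c A)) := by gcongr
    _ = _ := by ring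

/-- Cauchy-Schwarz over the fibres of `g`. -/
theorem sq_card_le_card_image_mul_card_collisions {P Y : Type*} [DecidableEq P] [DecidableEq Y]
    (S : Finset P) (g : P → Y) :
    #S ^ 2 ≤ #(S.image g) * #{z ∈ S ×ˢ S | g z.1 = g z.2} := by
  have h1 : #S = ∑ v ∈ S.image g, #{x ∈ S | g x = v} :=
    Finset.card_eq_sum_card_fiberwise fun x hx => Finset.mem_coe.2 (Finset.mem_image_of_mem g hx)
  have h2 : #{z ∈ S ×ˢ S | g z.1 = g z.2} = ∑ v ∈ S.image g, #{x ∈ S | g x = v} ^ 2 := by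
    rw [Finset.card_eq_sum_card_fiberwise (t := S.image g) (f := fun z : P × P => g z.1)]
    · refine Finset.sum_congr rfl fun v _ => ?_
      rw [sq, ← Finset.card_product]
      congr 1
      ext ⟨x, y⟩
      simp only [mem_filter, mem_product]
      constructor
      · rintro ⟨⟨⟨hx, hy⟩, h⟩, h'⟩
        exact ⟨⟨hx, h'⟩, hy, h ▸ h'⟩
      · rintro ⟨⟨hx, h⟩, hy, h'⟩
        exact ⟨⟨⟨hx, hy⟩, h.trans h'.symm⟩, h⟩
    · intro z hz
      exact Finset.mem_coe.2 (Finset.mem_image_of_mem g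
        (Finset.mem_product.1 (Finset.mem_filter.1 hz).1).1)
  rw [h2]
  nth_rewrite 1 [h1]
  exact sq_sum_le_card_mul_sum_sq

/-- If all pairs of coefficients cancel, the characteristic is two and all coefficients agree. -/
theorem supersaturation_of_pairwise_add_eq_zero {F : Type*} [Field F] [Fintype F]
    [DecidableEq F[X]] {s : ℕ} (hs : 3 ≤ s) {c : Fin s → F[X]} (hc0 : ∀ i, c i ≠ 0)
    (hsum : ∑ i, c i = 0) (hpair : ∀ i j, i ≠ j → c i + c j = 0) {N : ℕ}
    {A : Finset F[X]} (hA : ∀ x ∈ A, x.degree < N) :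
    #A ^ s ≤ #(zeroSums c A) * Fintype.card F ^ N := by
  have hconst : ∃ a, ∀ i, c i = a := by
    refine ⟨c ⟨0, by omega⟩, fun i => ?_⟩
    obtain ⟨k, hk1, hk2⟩ : ∃ k : Fin s, i ≠ k ∧ (⟨0, by omega⟩ : Fin s) ≠ k := by
      by_cases h : i = ⟨1, by omega⟩
      · exact ⟨⟨2, by omega⟩, by simp [h], by simp⟩
      · exact ⟨⟨1, by omega⟩, h, by simp⟩
    exact add_right_cancel ((hpair i k hk1).trans (hpair _ k hk2).symm)
  obtain ⟨a, ha⟩ := hconst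
  obtain rfl : c = fun _ => a := funext ha
  have ha0 : a ≠ 0 := hc0 ⟨0, by omega⟩
  have h2a : a + a = 0 := hpair ⟨0, by omega⟩ ⟨1, by omega⟩ (by simp)
  -- For odd `s` the relation `2a = 0` would reduce `s * a = 0` to `a = 0`.
  have heven : Even s := by
    by_contra h
    obtain ⟨r, rfl⟩ := Nat.not_even_iff_odd.1 h
    apply ha0
    rw [Finset.sum_const, Finset.card_univ, Fintype.card_fin, nsmul_eq_mul] at hsum
    push_cast at hsum
    linear_combination hsum - (r : F[X]) * h2a
  obtain ⟨r, rfl⟩ := heven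
  set S : Finset (Fin r → F[X]) := Fintype.piFinset fun _ => A with hS
  have h1 := sq_card_le_card_image_mul_card_collisions S fun x => ∑ i, x i
  have h2 : #(S.image fun x => ∑ i, x i) ≤ Fintype.card F ^ N := by
    refine card_le_of_degree_lt fun y hy => ?_
    obtain ⟨x, hx, rfl⟩ := Finset.mem_image.1 hy
    rw [← Polynomial.mem_degreeLT]
    exact Submodule.sum_mem _ fun i _ =>
      Polynomial.mem_degreeLT.2 (hA _ (Fintype.mem_piFinset.1 hx i))
  -- In characteristic two, two halves with equal sums concatenate to a solution.
  have h3 : #{z ∈ S ×ˢ S | ∑ i, z.1 i = ∑ i, z.2 i} ≤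
      #(zeroSums (fun _ : Fin (r + r) => a) A) := by
    refine Finset.card_le_card_of_injOn (fun z => Fin.append z.1 z.2) ?_ ?_
    · rintro ⟨x, y⟩ hz
      obtain ⟨hxy, h⟩ := Finset.mem_filter.1 (Finset.mem_coe.1 hz)
      obtain ⟨hx, hy⟩ := Finset.mem_product.1 hxy
      refine Finset.mem_coe.2 (mem_zeroSums.2 ⟨fun i => ?_, ?_⟩)
      · induction i using Fin.addCases with
        | left i => simpa using Fintype.mem_piFinset.1 hx i
        | right i =>
          simp only [Fin.append_right]
          exact Fintype.mem_piFinset.1 hy i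
      · rw [Fin.sum_univ_add]
        simp only [Fin.append_left, Fin.append_right, ← Finset.mul_sum]
        simp only at h
        rw [h]
        linear_combination (∑ i, y i) * h2a
    · rintro ⟨x, y⟩ _ ⟨x', y'⟩ _ h
      have hx : x = x' := funext fun i => by
        simpa using congrFun h (Fin.castAdd r i)
      have hy : y = y' := funext fun i => by
        have := congrFun h (Fin.natAdd r i)
        simpa only [Fin.append_right] using this
      rw [hx, hy]
  have h4 : #S = #A ^ r := by simp [hS]
  calc #A ^ (r + r) = #S ^ 2 := by rw [h4]; ring
    _ ≤ _ := h1
    _ ≤ Fintype.card F ^ N * #(zeroSums (fun _ : Fin (r + r) => a) A) := Nat.mul_le_mul h2 h3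
    _ = _ := mul_comm _ _

/-- Polynomial supersaturation for translation-invariant equations over `F_q[t]`. -/
theorem exists_supersaturation (s q ℓ : ℕ) :
    ∃ κ K : ℕ, ∀ (F : Type*) [Field F] [Fintype F], Fintype.card F = q →
      PolynomialSupersaturation F (s + 3) ℓ κ K := by
  obtain ⟨κ₃, K₃, h₃⟩ := exists_supersaturation_three q ℓ
  induction s with
  | zero => exact ⟨κ₃, K₃, h₃⟩
  | succ s ih =>
    obtain ⟨κ, K, h⟩ := ih
    -- The sum of the exponents of the two cases; `#A ≤ G` absorbs the surplus in each. The `+ 1`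
    -- covers the case of cancelling pairs.
    refine ⟨(κ + κ₃) + (s + 4), 2 ^ (κ + κ₃) * K₃ * K + 1, ?_⟩
    intro F _ _ hF _ c hc0 hcℓ hsum N A hAne hA
    set G := Fintype.card F ^ N with hG
    have hAG : #A ≤ G := card_le_of_degree_lt hA
    rw [show s + 1 + 3 - 1 = s + 3 by omega]
    by_cases hpair : ∀ i j, i ≠ j → c i + c j = 0
    · have h1 : #A ^ (s + 4) ≤ #(zeroSums c A) * G :=
        supersaturation_of_pairwise_add_eq_zero (by omega) hc0 hsum hpair hA
      calc #A ^ (κ + κ₃ + (s + 4)) * G ^ (s + 3)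
          = #A ^ (κ + κ₃) * #A ^ (s + 4) * G ^ (s + 3) := by ring
        _ ≤ G ^ (κ + κ₃) * (#(zeroSums c A) * G) * G ^ (s + 3) := by gcongr
        _ = 1 * #(zeroSums c A) * G ^ (κ + κ₃ + (s + 4)) := by ring
        _ ≤ _ := by gcongr; omega
    · push Not at hpair
      obtain ⟨i, j, hij, hne⟩ := hpair
      obtain ⟨σ, hσ0, hσ1⟩ := exists_perm_map_pair (s := s + 2) hij
      have h1 := supersaturation_of_add_ne_zero (h₃ F hF) (h F hF) (c := c ∘ σ) (fun i => hc0 _)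
        (fun i => hcℓ _) (by rw [← hsum]; exact Equiv.sum_comp σ c)
        (by simpa only [Function.comp_apply, hσ0, hσ1] using hne) hAne hA
      rw [card_zeroSums_comp_perm] at h1
      calc #A ^ (κ + κ₃ + (s + 4)) * G ^ (s + 3)
          = #A ^ (s + 4) * (#A ^ (κ + κ₃) * G ^ (s + 2 + 1)) := by ring
        _ ≤ G ^ (s + 4) * (2 ^ (κ + κ₃) * K₃ * K * #(zeroSums c A) * G ^ (κ + κ₃)) := by gcongr
        _ = 2 ^ (κ + κ₃) * K₃ * K * #(zeroSums c A) * G ^ (κ + κ₃ + (s + 4)) := by ring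
        _ ≤ _ := by gcongr; omega

/-! ### From the polynomial bound to the exponential one -/

namespace TranslationInvariant

theorem HasGenus.sum_eq_zero {R : Type*} [CommRing R] {s : ℕ} {c : Fin s → R} {m : ℕ}
    (h : HasGenus c m) : ∑ i, c i = 0 := by
  obtain ⟨P, -, hP⟩ := h.1
  rw [← P.biUnion_parts, Finset.sum_biUnion P.disjoint]
  exact Finset.sum_eq_zero hP

theorem ncard_truncation (F : Type*) [Field F] [Fintype F] (N : ℕ) :
    (truncation F N).ncard = Fintype.card F ^ N := by
  rw [← natCard_degreeLT, ← Nat.card_coe_set_eq]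
  refine Nat.card_congr (Equiv.setCongr ?_)
  ext x
  exact Polynomial.mem_degreeLT.symm

end TranslationInvariant

/-- With `L = log (1 / α) ≥ 1` and `α ^ (-t) ≥ 1`, the exponent is at least `κ * L + K` in absolute
value; `exp (-κ * L)` is `α ^ κ`, and `exp K ≥ K` absorbs the constant. -/
theorem exp_neg_mul_rpow_mul_log_pow_le {α t : ℝ} (hα : 0 < α) (hα' : α < 1 / Real.exp 1 ^ 2)
    (ht : 0 ≤ t) (κ K : ℕ) :
    Real.exp (-((κ : ℝ) + K + 1) * α ^ (-t) * Real.log (1 / α) ^ 4) * K ≤ α ^ κ := by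
  have hL : 1 ≤ Real.log (1 / α) := by
    rw [Real.le_log_iff_exp_le (by positivity), le_div_iff₀ hα]
    have he : (1 : ℝ) ≤ Real.exp 1 := Real.one_le_exp (by norm_num)
    rw [lt_div_iff₀ (by positivity)] at hα'
    nlinarith [mul_nonneg hα.le (Real.exp_pos 1).le]
  have hα1 : α ≤ 1 := by
    have he : (1 : ℝ) ≤ Real.exp 1 ^ 2 := one_le_pow₀ (Real.one_le_exp (by norm_num))
    exact hα'.le.trans (div_le_one_of_le₀ he (by positivity))
  have hp : 1 ≤ α ^ (-t) := Real.one_le_rpow_of_pos_of_le_one_of_nonpos hα hα1 (by linarith)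
  set L := Real.log (1 / α) with hLdef
  have hαL : α = Real.exp (-L) := by
    rw [hLdef, one_div, Real.log_inv, neg_neg, Real.exp_log hα]
  have h1 : (κ : ℝ) * L + K ≤ ((κ : ℝ) + K + 1) * α ^ (-t) * L ^ 4 := by
    have hL4 : L ≤ L ^ 4 := le_self_pow₀ hL (by norm_num)
    calc (κ : ℝ) * L + K ≤ (κ + K + 1) * 1 * L := by nlinarith [Nat.cast_nonneg (α := ℝ) K]
      _ ≤ _ := by gcongr
  have hK : (K : ℝ) ≤ Real.exp K := by linarith [Real.add_one_le_exp (K : ℝ)]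
  calc _ ≤ Real.exp (-((κ : ℝ) * L + K)) * Real.exp K := by
        gcongr
        linarith
    _ = α ^ κ := by
        rw [← Real.exp_add, hαL, ← Real.exp_nat_mul]
        ring_nf
theorem mainTheorem3 (s : ℕ) (hs : 3 ≤ s) (q ℓ : ℕ) :
    ∃ C : ℝ, 0 < C ∧
      ∀ (F : Type*) [Field F] [Fintype F], Fintype.card F = q →
      ∀ (c : Fin s → F[X]), (∀ i, c i ≠ 0) →
        (Finset.univ.sup fun i => (c i).natDegree) = ℓ →
      ∀ m : ℕ, 1 ≤ m → TranslationInvariant.HasGenus c m →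
      ∀ (N : ℕ) (A : Set F[X]), A ⊆ TranslationInvariant.truncation F N → A.Nonempty →
      ∀ α : ℝ, α = TranslationInvariant.density N A → α < 1 / Real.exp 1 ^ 2 →
        Real.exp (-C * α ^ (-(1 / ((s : ℝ) - 2))) * Real.log (1 / α) ^ 4) ≤
          TranslationInvariant.solutionDensity N c A := by
  classical
  obtain ⟨r, rfl⟩ := Nat.exists_eq_add_of_le' hs
  obtain ⟨κ, K, hκ⟩ := exists_supersaturation r q ℓ
  refine ⟨κ + K + 1, by positivity, ?_⟩
  intro F _ _ hF c hc0 hcℓ m _ hgenus N A hA hAne α hα hα'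
  have hG0 : 0 < Fintype.card F ^ N := pow_pos Fintype.card_pos _
  have hfin : A.Finite := by
    refine (Set.finite_of_ncard_pos ?_).subset hA
    rwa [TranslationInvariant.ncard_truncation]
  lift A to Finset F[X] using hfin
  have hmain := hκ F hF c hc0
    (fun i => by rw [← hcℓ]; exact Finset.le_sup (f := fun i => (c i).natDegree) (mem_univ i))
    hgenus.sum_eq_zero N A (by exact_mod_cast hAne) fun x hx => hA hx
  have hsol : TranslationInvariant.solutions c (A : Set F[X]) = (zeroSums c A : Set _) := by
    ext x
    simp [TranslationInvariant.solutions, mem_zeroSums]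
  rw [TranslationInvariant.solutionDensity, hsol, Set.ncard_coe_finset,
    TranslationInvariant.ncard_truncation]
  rw [TranslationInvariant.density, Set.ncard_coe_finset,
    TranslationInvariant.ncard_truncation] at hα
  set G := Fintype.card F ^ N with hG
  have hG0' : (0 : ℝ) < G := by exact_mod_cast hG0
  have hA0 : (0 : ℝ) < #A := by
    exact_mod_cast Finset.card_pos.2 (by exact_mod_cast hAne)
  have hα0 : 0 < α := by rw [hα]; positivity
  have hmainR : α ^ κ * (G : ℝ) ^ (r + 3 - 1) ≤ K * #(zeroSums c A) := by
    rw [hα, div_pow, div_mul_eq_mul_div, div_le_iff₀ (by positivity)]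
    exact_mod_cast hmain
  have hK0 : (0 : ℝ) < K := by
    have h1 : 0 < (K : ℝ) * #(zeroSums c A) := lt_of_lt_of_le (by positivity) hmainR
    exact pos_of_mul_pos_left h1 (by positivity)
  have ht : 0 ≤ 1 / (((r + 3 : ℕ) : ℝ) - 2) := by
    refine div_nonneg zero_le_one ?_
    push_cast
    linarith [Nat.cast_nonneg (α := ℝ) r]
  have hexp := exp_neg_mul_rpow_mul_log_pow_le hα0 hα' ht κ K
  rw [le_div_iff₀ (by positivity)]
  refine le_of_mul_le_mul_left ?_ hK0
  refine le_trans ?_ hmainR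
  rw [← mul_assoc]
  gcongr
  rwa [mul_comm]
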